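/- Let $(X,\mathscr T)$ be a real topological vector space (a complex one is regarded as a real one; no Hausdorff assumption is made), and let $\mathscr R$ be a locally convex vector space topology on $X$ that is weaker than $\mathscr T$, i.e. $\mathscr R\subseteq\mathscr T$. Let $C\subseteq X$ be almost convex in $(X,\mathscr T)$; this means that $C$ is nonempty and that for every $\mathscr T$-neighborhood $V$ of $0$ and every finite family $x_1,\dots,x_n\in C$ there are $z_1,\dots,z_n\in C$ such that $\operatorname{co}\{z_1,\dots,z_n\}\subseteq C$ and $z_i-x_i\in V$ for all $i=1,\dots,n$. Let $\overline{C}$ be the $\mathscr T$-closure of $C$ and let $f\colon C\to\overline{C}$ be $\mathscr T$-to-$\mathscr R$ sequentially continuous, i.e. whenever $x_n\to x$ in $\mathscr T$ with $x_n,x\in C$, then $f(x_n)\to f(x)$ in $\mathscr R$. Assume that $f(C)$ is $\mathscr R$-totally bounded. Then $f$ has an approximate fixed point net with respect to $\mathscr R$: there is a net $(x_i)_{i\in I}$ in $C$, indexed by a nonempty directed set $I$, such that $x_i-f(x_i)\to 0$ in the topology $\mathscr R$. -/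

import Mathlib

open Filter Topology

universe u

/-- A nonempty subset `C` of a topological vector space is almost convex if any finitely many points
`x₁, …, xₙ` of `C` can be moved, each by an element of a prescribed neighbourhood of `0`, to points
`z₁, …, zₙ` of `C` whose convex hull lies in `C`. -/
def AlmostConvex {X : Type u} [AddCommGroup X] [Module ℝ X] (T : TopologicalSpace X)
    (C : Set X) : Prop :=
  C.Nonempty ∧ ∀ V ∈ @nhds X T 0, ∀ (n : ℕ) (x : Fin n → X), (∀ i, x i ∈ C) →
    ∃ z : Fin n → X, (∀ i, z i ∈ C) ∧ convexHull ℝ (Set.range z) ⊆ C ∧ ∀ i, z i - x i ∈ V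

/-- `f : C → X` has an approximate fixed point net for the topology `R`: there is a net `(xᵢ)` in
`C`, indexed by a nonempty directed set, such that `xᵢ - f xᵢ → 0` in `R`. -/
def HasApproxFixedPointNet {X : Type u} [AddCommGroup X] (R : TopologicalSpace X) {C : Set X}
    (f : C → X) : Prop :=
  ∃ (ι : Type u) (_ : Preorder ι) (_ : IsDirectedOrder ι) (_ : Nonempty ι) (x : ι → C),
    Tendsto (fun i => (x i : X) - f (x i)) atTop (@nhds X R 0)

section Scarf

variable {S I L : Type*} [LinearOrder L]

/-- A finite set `σ` is dominant for a family of orders, given by the injections `u i`, if every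
point lies below all of `σ` in at least one of these orders. -/
def ScarfDominant (u : I → S → L) (σ : Finset S) : Prop :=
  ∀ y, ∃ i, ∀ x ∈ σ, u i y ≤ u i x

theorem ScarfDominant.mono {u : I → S → L} {σ τ : Finset S} (h : ScarfDominant u τ)
    (hs : σ ⊆ τ) : ScarfDominant u σ := fun y =>
  let ⟨i, hi⟩ := h y
  ⟨i, fun x hx => hi x (hs hx)⟩

variable [DecidableEq S] [Fintype I]

/-- A surjection onto a set with one element less identifies exactly one pair. -/
theorem exists_unique_collision [DecidableEq I] {σ : Finset S} (hcard : σ.card + 1 = Fintype.card I)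
    (μ : I → S)
    (hμ : ∀ i, μ i ∈ σ) (hsurj : ∀ x ∈ σ, ∃ i, μ i = x) :
    ∃ i j, i ≠ j ∧ μ i = μ j ∧ ∀ k l, k ≠ l → μ k = μ l → k = i ∨ k = j := by
  obtain ⟨i, -, j, -, hij, he⟩ := Finset.exists_ne_map_eq_of_card_lt_of_maps_to
    (s := (Finset.univ : Finset I)) (t := σ) (by rw [Finset.card_univ]; omega)
    (f := μ) (fun i _ => hμ i)
  refine ⟨i, j, hij, he, fun k l hkl hkle => ?_⟩
  by_contra! hk
  have h1 : σ ⊆ ((Finset.univ.erase k).erase i).image μ := by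
    intro x hx
    obtain ⟨p, rfl⟩ := hsurj x hx
    by_cases hpk : p = k
    · subst hpk
      by_cases hli : l = i
      · subst hli
        exact Finset.mem_image.2 ⟨j, by simp [hij.symm, hk.2.symm], by rw [← he, hkle]⟩
      · exact Finset.mem_image.2 ⟨l, by simp [hkl.symm, hli], hkle.symm⟩
    · by_cases hpi : p = i
      · subst hpi
        exact Finset.mem_image.2 ⟨j, by simp [hij.symm, hk.2.symm], he.symm⟩
      · exact Finset.mem_image.2 ⟨p, by simp [hpk, hpi], rfl⟩
  have h2 := (Finset.card_le_card h1).trans Finset.card_image_le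
  rw [Finset.card_erase_of_mem (by simp [hk.1.symm]), Finset.card_erase_of_mem (by simp),
    Finset.card_univ] at h2
  have : 2 ≤ Fintype.card I := by
    rw [← Finset.card_univ, ← Finset.card_pair hij]
    exact Finset.card_le_card (Finset.subset_univ _)
  omega

/-- In a dominant set of cardinality `card I`, every point is the strict minimum in exactly one
order. -/
theorem ScarfDominant.exists_bijective {u : I → S → L} (hu : ∀ i, Function.Injective (u i))
    {τ : Finset S} (h : ScarfDominant u τ)
    (hcard : τ.card = Fintype.card I) :
    ∃ ν : I → S, Function.Injective ν ∧ (∀ x ∈ τ, ∃ i, ν i = x) ∧ (∀ i, ν i ∈ τ) ∧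
      ∀ i, ∀ x ∈ τ, u i (ν i) ≤ u i x := by
  rcases isEmpty_or_nonempty I with hI | hI
  · have : τ = ∅ := by rw [← Finset.card_eq_zero, hcard]; exact Fintype.card_eq_zero
    subst this
    exact ⟨fun i => hI.elim i, fun i => hI.elim i, by simp, fun i => hI.elim i,
      fun i => hI.elim i⟩
  have hne : τ.Nonempty := by
    rw [← Finset.card_pos, hcard]; exact Fintype.card_pos
  choose ν hν hmin using fun i => τ.exists_min_image (u i) hne
  have hs : ∀ x ∈ τ, ∃ i, ν i = x := fun x hx => by
    obtain ⟨i, hi⟩ := h x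
    exact ⟨i, hu i (le_antisymm (hmin i x hx) (hi _ (hν i)))⟩
  refine ⟨ν, ?_, hs, hν, hmin⟩
  have himg : Finset.univ.image ν = τ := by
    ext x
    simp only [Finset.mem_image, Finset.mem_univ, true_and]
    exact ⟨by rintro ⟨i, rfl⟩; exact hν i, hs x⟩
  rw [← Set.injOn_univ, ← Finset.coe_univ, ← Finset.card_image_iff, himg, hcard, Finset.card_univ]

/-- A dominant set of cardinality `card I - 1` has exactly two dominant one-point extensions,
provided that for each `i` some point exceeds its minima in all orders but the `i`-th. -/
theorem ScarfDominant.card_extensions [Fintype S] [DecidableEq I] {u : I → S → L}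
    (hu : ∀ i, Function.Injective (u i)) {σ : Finset S} (h : ScarfDominant u σ) (hne : σ.Nonempty)
    (hcard : σ.card + 1 = Fintype.card I)
    (hM : ∀ i, ∃ z, ∀ k, k ≠ i → ∃ x ∈ σ, u k x < u k z)
    (E : Finset S) (hE : ∀ y, y ∈ E ↔ y ∉ σ ∧ ScarfDominant u (insert y σ)) :
    E.card = 2 := by
  classical
  choose μ hμ hmin using fun i => σ.exists_min_image (u i) hne
  have hs : ∀ x ∈ σ, ∃ i, μ i = x := fun x hx => by
    obtain ⟨i, hi⟩ := h x
    exact ⟨i, hu i (le_antisymm (hmin i x hx) (hi _ (hμ i)))⟩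
  obtain ⟨i, j, hij, he, huniq⟩ := exists_unique_collision hcard μ hμ hs
  have hmax : ∀ i, ∃ y, (∀ k, k ≠ i → u k (μ k) < u k y) ∧
      ∀ z, (∀ k, k ≠ i → u k (μ k) < u k z) → u i z ≤ u i y := by
    intro i
    obtain ⟨z, hz⟩ := hM i
    obtain ⟨y, hy, hy'⟩ := Finset.exists_max_image
      (Finset.univ.filter fun z => ∀ k, k ≠ i → u k (μ k) < u k z) (u i)
      ⟨z, by
        simp only [Finset.mem_filter, Finset.mem_univ, true_and]
        intro k hk
        obtain ⟨x, hx, hxz⟩ := hz k hk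
        exact (hmin k x hx).trans_lt hxz⟩
    simp only [Finset.mem_filter, Finset.mem_univ, true_and] at hy hy'
    exact ⟨y, hy, hy'⟩
  choose w hw hwmax using hmax
  have key : ∀ i j, i ≠ j → μ i = μ j → w i ∈ E := by
    intro i j hij he
    refine (hE _).2 ⟨fun hmem => ?_, fun z => ?_⟩
    · obtain ⟨k, hk⟩ := hs _ hmem
      by_cases hki : k = i
      · have := hw i j hij.symm
        rw [show w i = μ j by rw [← hk, hki, he]] at this
        exact lt_irrefl _ this
      · have := hw i k hki
        rw [hk] at this
        exact lt_irrefl _ this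
    · obtain ⟨l, hl⟩ := h z
      by_cases hz : ∀ k, k ≠ i → u k (μ k) < u k z
      · refine ⟨i, fun x hx => ?_⟩
        rcases Finset.mem_insert.1 hx with rfl | hx
        · exact hwmax i z hz
        · by_cases hli : l = i
          · exact hli ▸ hl x hx
          · exact absurd (hl _ (hμ l)) (not_le.2 (hz l hli))
      · push Not at hz
        obtain ⟨k, hki, hk⟩ := hz
        refine ⟨k, fun x hx => ?_⟩
        rcases Finset.mem_insert.1 hx with rfl | hx
        · exact hk.trans (hw i k hki).le
        · exact hk.trans (hmin k x hx)
  rw [Finset.card_eq_two]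
  refine ⟨w i, w j, fun hww => ?_, ?_⟩
  · obtain ⟨k, hk⟩ := h (w i)
    have hk := hk _ (hμ k)
    by_cases hki : k = i
    · subst hki
      rw [hww] at hk
      exact absurd hk (not_le.2 (hw j k hij))
    · exact absurd hk (not_le.2 (hw i k hki))
  · ext y
    simp only [Finset.mem_insert, Finset.mem_singleton]
    refine ⟨fun hy => ?_, ?_⟩
    · obtain ⟨hyσ, hdom⟩ := (hE y).1 hy
      obtain ⟨ν, hinj, hsν, hνm, hνmin⟩ :=
        hdom.exists_bijective hu (by rw [Finset.card_insert_of_notMem hyσ, hcard])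
      obtain ⟨k, hk⟩ := hsν y (Finset.mem_insert_self _ _)
      have hνμ : ∀ l, l ≠ k → ν l = μ l := by
        intro l hl
        have h1 : ν l ∈ σ := (Finset.mem_insert.1 (hνm l)).resolve_left fun h =>
          hl (hinj (h.trans hk.symm))
        exact hu l (le_antisymm (hνmin l _ (Finset.mem_insert_of_mem (hμ l))) (hmin l _ h1))
      have hyM : ∀ l, l ≠ k → u l (μ l) < u l y := by
        intro l hl
        refine lt_of_le_of_ne ?_ fun h => hyσ (hu l h ▸ hμ l)
        rw [← hνμ l hl]
        exact hνmin l _ (Finset.mem_insert_self _ _)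
      have hyw : y = w k := by
        refine hu k (le_antisymm (hwmax k y hyM) ?_)
        obtain ⟨l, hl⟩ := hdom (w k)
        by_cases hlk : l = k
        · exact hlk ▸ hl y (Finset.mem_insert_self _ _)
        · exact absurd (hl _ (Finset.mem_insert_of_mem (hμ l))) (not_le.2 (hw k l hlk))
      obtain ⟨l, hl⟩ := hsν (μ k) (Finset.mem_insert_of_mem (hμ k))
      have hlk : l ≠ k := by
        rintro rfl
        exact hyσ (hk ▸ hl ▸ hμ l)
      rw [hνμ l hlk] at hl
      rcases huniq k l hlk.symm hl.symm with rfl | rfl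
      · exact Or.inl hyw
      · exact Or.inr hyw
    · rintro (rfl | rfl)
      · exact key i j hij he
      · exact key j i hij.symm he.symm

/-- Scarf's lemma. Let `e i` be the least element in the `i`-th order and above all elements outside
the range of `e` in the other orders. Then every colouring with `c (e i) = i` has a dominant set
that meets all colours. -/
theorem exists_dominant_colorful [Fintype S] [DecidableEq I] {u : I → S → L}
    (hu : ∀ i, Function.Injective (u i)) (e : I → S) (hbot : ∀ i y, y ≠ e i → u i (e i) < u i y)
    (htop : ∀ i j y, j ≠ i → y ∉ Set.range e → u i y < u i (e j))
    (hne : ∃ y, y ∉ Set.range e) (c : S → I) (hc : ∀ i, c (e i) = i) :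
    ∃ τ : Finset S, ScarfDominant u τ ∧ τ.card = Fintype.card I ∧ ∀ i, ∃ x ∈ τ, c x = i := by
  classical
  have heinj : Function.Injective e := fun i j h => by rw [← hc i, h, hc j]
  by_contra! hcon
  obtain ⟨y₀, hy₀⟩ := hne
  let i₀ : I := c y₀
  let rooms : Finset (Finset S) :=
    Finset.univ.filter fun τ => ScarfDominant u τ ∧ τ.card = Fintype.card I
  let doors : Finset (Finset S) :=
    Finset.univ.filter fun σ => σ.card + 1 = Fintype.card I ∧ σ.image c = Finset.univ.erase i₀
  let ext : Finset S → Finset S := fun σ =>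
    Finset.univ.filter fun y => y ∉ σ ∧ ScarfDominant u (insert y σ)
  have hcount := Finset.sum_card_bipartiteAbove_eq_sum_card_bipartiteBelow
    (s := doors) (t := rooms) (fun σ τ => σ ⊆ τ)
  let σ₀ : Finset S := (Finset.univ.erase i₀).image e
  have hσ₀card : σ₀.card + 1 = Fintype.card I := by
    rw [Finset.card_image_of_injective _ heinj, Finset.card_erase_of_mem (Finset.mem_univ _),
      Finset.card_univ, Nat.sub_add_cancel (Fintype.card_pos_iff.2 ⟨i₀⟩)]
  have hσ₀ : σ₀ ∈ doors := by
    simp only [doors, Finset.mem_filter, Finset.mem_univ, true_and]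
    refine ⟨hσ₀card, ?_⟩
    rw [Finset.image_image, show c ∘ e = id from funext hc, Finset.image_id]
  have habove : ∀ σ ∈ doors, (rooms.bipartiteAbove (fun σ τ => σ ⊆ τ) σ).card = (ext σ).card := by
    intro σ hσ
    simp only [doors, Finset.mem_filter, Finset.mem_univ, true_and] at hσ
    symm
    refine Finset.card_bij (fun y _ => insert y σ) ?_ ?_ ?_
    · intro y hy
      simp only [ext, Finset.mem_filter, Finset.mem_univ, true_and] at hy
      simp only [Finset.mem_bipartiteAbove, rooms, Finset.mem_filter, Finset.mem_univ, true_and]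
      exact ⟨⟨hy.2, by rw [Finset.card_insert_of_notMem hy.1, hσ.1]⟩, Finset.subset_insert _ _⟩
    · intro y hy z hz hyz
      simp only [ext, Finset.mem_filter, Finset.mem_univ, true_and] at hy
      have : y ∈ insert z σ := hyz ▸ Finset.mem_insert_self _ _
      exact (Finset.mem_insert.1 this).resolve_right hy.1
    · intro τ hτ
      simp only [Finset.mem_bipartiteAbove, rooms, Finset.mem_filter, Finset.mem_univ,
        true_and] at hτ
      obtain ⟨y, hy, rfl⟩ := (Finset.covBy_iff_exists_insert (s := σ) (t := τ)).1
        (Finset.covBy_iff_card_sdiff_eq_one.2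
          ⟨hτ.2, by rw [Finset.card_sdiff_of_subset hτ.2]; omega⟩)
      exact ⟨y, by simp [ext, hy, hτ.1.1], rfl⟩
  have hbelow : ∀ τ ∈ rooms, Even (doors.bipartiteBelow (fun σ τ => σ ⊆ τ) τ).card := by
    intro τ hτ
    simp only [rooms, Finset.mem_filter, Finset.mem_univ, true_and] at hτ
    have hI : (doors.bipartiteBelow (fun σ τ => σ ⊆ τ) τ).card =
        (τ.filter fun x => (τ.erase x).image c = Finset.univ.erase i₀).card := by
      symm
      refine Finset.card_bij (fun x _ => τ.erase x) ?_ ?_ ?_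
      · intro x hx
        rw [Finset.mem_filter] at hx
        simp only [Finset.mem_bipartiteBelow, doors, Finset.mem_filter, Finset.mem_univ, true_and]
        exact ⟨⟨by rw [Finset.card_erase_add_one hx.1, hτ.2], hx.2⟩, Finset.erase_subset _ _⟩
      · intro x hx y hy hxy
        rw [Finset.mem_filter] at hx hy
        by_contra hne
        have : x ∈ τ.erase y := Finset.mem_erase.2 ⟨hne, hx.1⟩
        rw [← hxy] at this
        exact Finset.notMem_erase _ _ this
      · intro σ hσ
        simp only [Finset.mem_bipartiteBelow, doors, Finset.mem_filter, Finset.mem_univ,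
          true_and] at hσ
        obtain ⟨y, hy, rfl⟩ := (Finset.covBy_iff_exists_insert (s := σ) (t := τ)).1
          (Finset.covBy_iff_card_sdiff_eq_one.2
            ⟨hσ.2, by rw [Finset.card_sdiff_of_subset hσ.2]; omega⟩)
        have hins : (insert y σ).erase y = σ := Finset.erase_insert hy
        exact ⟨y, by simp [hins, hσ.1.2], hins⟩
    rw [hI]
    rcases Finset.eq_empty_or_nonempty
      (τ.filter fun x => (τ.erase x).image c = Finset.univ.erase i₀) with h0 | ⟨x, hx⟩
    · simp [h0]
    rw [Finset.mem_filter] at hx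
    obtain ⟨k, hk⟩ := hcon τ hτ.1 hτ.2
    have hmem : ∀ i, i ≠ i₀ → ∃ z ∈ τ.erase x, c z = i := fun i hi => by
      rw [← Finset.mem_image, hx.2]; simp [hi]
    have hki : k = i₀ := by
      by_contra hki
      obtain ⟨z, hz, hzc⟩ := hmem k hki
      exact hk z (Finset.mem_of_mem_erase hz) hzc
    subst hki
    have hinj : Set.InjOn c (τ.erase x) := by
      rw [← Finset.card_image_iff, hx.2, Finset.card_erase_of_mem (Finset.mem_univ _),
        Finset.card_univ, Finset.card_erase_of_mem hx.1, hτ.2]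
    obtain ⟨z, hz, hzc⟩ := hmem (c x) (hk x hx.1)
    have hzx : z ≠ x := Finset.ne_of_mem_erase hz
    have hzτ : z ∈ τ := Finset.mem_of_mem_erase hz
    rw [(Finset.card_eq_two (s := τ.filter _)).2 ⟨x, z, hzx.symm, ?_⟩]
    · exact even_two
    ext y
    simp only [Finset.mem_filter, Finset.mem_insert, Finset.mem_singleton]
    constructor
    · rintro ⟨hy, hyimg⟩
      by_contra! hne
      have : c y ∈ (τ.erase y).image c := by
        rw [hyimg]; simp [hk y hy]
      obtain ⟨p, hp, hpc⟩ := Finset.mem_image.1 this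
      have hpy := Finset.ne_of_mem_erase hp
      by_cases hpx : p = x
      · subst hpx
        exact hne.2 (hinj (by simp [hne.1, hy]) (by simp [hzx, hzτ]) (by rw [hzc, hpc]))
      · exact hpy (hinj (by simp [hpx, Finset.mem_of_mem_erase hp]) (by simp [hne.1, hy]) hpc)
    · rintro (rfl | rfl)
      · exact hx
      · refine ⟨hzτ, ?_⟩
        rw [← hx.2]
        ext i
        simp only [Finset.mem_image, Finset.mem_erase]
        constructor
        · rintro ⟨p, ⟨hp1, hp2⟩, rfl⟩
          by_cases hpx : p = x
          · exact ⟨y, ⟨hzx, hzτ⟩, hpx ▸ hzc⟩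
          · exact ⟨p, ⟨hpx, hp2⟩, rfl⟩
        · rintro ⟨p, ⟨hp1, hp2⟩, rfl⟩
          by_cases hpy : p = y
          · exact ⟨x, ⟨hzx.symm, hx.1⟩, hpy ▸ hzc.symm⟩
          · exact ⟨p, ⟨hpy, hp2⟩, rfl⟩
  have hext : ∀ σ ∈ doors, σ ≠ σ₀ → Even (ext σ).card := by
    intro σ hσ hσne
    simp only [doors, Finset.mem_filter, Finset.mem_univ, true_and] at hσ
    rcases Finset.eq_empty_or_nonempty (ext σ) with h0 | ⟨y, hy⟩
    · simp [h0]
    simp only [ext, Finset.mem_filter, Finset.mem_univ, true_and] at hy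
    have hspecial : ∀ k, ¬ σ ⊆ (Finset.univ.erase k).image e := by
      intro k hsub
      have heq : σ = (Finset.univ.erase k).image e := by
        refine Finset.eq_of_subset_of_card_le hsub ?_
        rw [Finset.card_image_of_injective _ heinj, Finset.card_erase_of_mem (Finset.mem_univ _),
          Finset.card_univ]
        omega
      have h2 := hσ.2
      rw [heq, Finset.image_image, show c ∘ e = id from funext hc, Finset.image_id] at h2
      have : k = i₀ := by
        by_contra hk
        have : k ∈ Finset.univ.erase k := h2 ▸ (by simp [hk])
        exact Finset.notMem_erase _ _ this
      exact hσne (by rw [heq, this])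
    rw [ScarfDominant.card_extensions hu (hy.2.mono (Finset.subset_insert _ _)) ?_ hσ.1 ?_ (ext σ)
      (by simp [ext])]
    · exact even_two
    · rw [Finset.nonempty_iff_ne_empty]
      rintro rfl
      exact hspecial i₀ (Finset.empty_subset _)
    · intro i
      refine ⟨e i, fun k hk => ?_⟩
      by_contra! hlow
      refine hspecial k fun x hx => ?_
      by_cases hxr : x ∈ Set.range e
      · obtain ⟨l, rfl⟩ := hxr
        refine Finset.mem_image.2 ⟨l, ?_, rfl⟩
        simp only [Finset.mem_erase, Finset.mem_univ, and_true]
        rintro rfl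
        exact absurd (hlow _ hx) (not_le.2 (hbot l _ (heinj.ne hk.symm)))
      · exact absurd (hlow _ hx) (not_le.2 (htop k i x hk.symm hxr))
  have hext₀ : (ext σ₀).card = 1 := by
    obtain ⟨w, hw, hwmax⟩ := Finset.exists_max_image
      (Finset.univ.filter fun y => y ∉ Set.range e) (u i₀) ⟨y₀, by simpa using hy₀⟩
    rw [Finset.mem_filter] at hw
    replace hwmax : ∀ y, y ∉ Set.range e → u i₀ y ≤ u i₀ w := fun y hy =>
      hwmax y (Finset.mem_filter.2 ⟨Finset.mem_univ _, hy⟩)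
    have hcrit : ∀ y, y ∉ Set.range e → ScarfDominant u (insert y σ₀) → ∀ z, z ∉ Set.range e →
        u i₀ z ≤ u i₀ y := by
      intro y _ hdom z hz
      obtain ⟨l, hl⟩ := hdom z
      by_cases hli : l = i₀
      · exact hli ▸ hl y (Finset.mem_insert_self _ _)
      · have := hl (e l) (Finset.mem_insert_of_mem (Finset.mem_image.2 ⟨l, by simp [hli], rfl⟩))
        exact absurd this (not_le.2 (hbot l z fun h => hz ⟨l, h.symm⟩))
    rw [Finset.card_eq_one]
    refine ⟨w, ?_⟩
    ext y
    simp only [ext, Finset.mem_filter, Finset.mem_univ, true_and, Finset.mem_singleton]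
    constructor
    · rintro ⟨hyσ, hdom⟩
      have hyr : y ∉ Set.range e := by
        rintro ⟨l, rfl⟩
        by_cases hli : l = i₀
        · subst hli
          obtain ⟨p, hp⟩ := hdom w
          have hmem : e p ∈ insert (e i₀) σ₀ := by
            by_cases hpi : p = i₀
            · rw [hpi]; exact Finset.mem_insert_self _ _
            · exact Finset.mem_insert_of_mem (Finset.mem_image.2 ⟨p, by simp [hpi], rfl⟩)
          exact absurd (hp _ hmem) (not_le.2 (hbot p w fun h => hw.2 ⟨p, h.symm⟩))
        · exact hyσ (Finset.mem_image.2 ⟨l, by simp [hli], rfl⟩)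
      exact hu i₀ (le_antisymm (hwmax y hyr) (hcrit y hyr hdom w hw.2))
    · rintro rfl
      refine ⟨fun h => ?_, fun z => ?_⟩
      · obtain ⟨l, -, hl⟩ := Finset.mem_image.1 h
        exact hw.2 ⟨l, hl⟩
      · by_cases hz : z ∈ Set.range e
        · obtain ⟨l, rfl⟩ := hz
          refine ⟨l, fun x _ => ?_⟩
          by_cases hx : x = e l
          · rw [hx]
          · exact (hbot l x hx).le
        · refine ⟨i₀, fun x hx => ?_⟩
          rcases Finset.mem_insert.1 hx with rfl | hx
          · exact hwmax z hz
          · obtain ⟨l, hl, rfl⟩ := Finset.mem_image.1 hx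
            exact (htop i₀ l z (Finset.ne_of_mem_erase hl) hz).le
  have h1 : Even (∑ τ ∈ rooms, (doors.bipartiteBelow (fun σ τ => σ ⊆ τ) τ).card) :=
    Finset.even_sum _ hbelow
  rw [← hcount, ← Finset.add_sum_erase _ _ hσ₀, habove _ hσ₀, hext₀, add_comm,
    Nat.even_add_one] at h1
  refine h1 (Finset.even_sum _ fun σ hσ => ?_)
  rw [habove _ (Finset.mem_of_mem_erase hσ)]
  exact hext σ (Finset.mem_of_mem_erase hσ) (Finset.ne_of_mem_erase hσ)

end Scarf

section Brouwer

variable {I : Type*} [Fintype I] [Nonempty I]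

/-- Given a colouring of the lattice points of a dilated simplex, there are a set `C` of coordinates
and a small cluster of lattice points that carries all colours in `C` and on which the coordinates
outside `C` are small. -/
theorem exists_cluster_colorful (m : ℕ) (c : (I → ℕ) → I) :
    ∃ (A : Finset (I → ℕ)) (C : Finset I), A.Nonempty ∧ (∀ a ∈ A, ∑ i, a i = m) ∧
      (∀ i ∈ C, ∃ a ∈ A, c a = i) ∧
      (∀ i ∈ C, ∀ a ∈ A, ∀ b ∈ A, a i ≤ b i + Fintype.card I) ∧
      ∀ i ∉ C, ∀ a ∈ A, a i ≤ Fintype.card I := by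
  classical
  let T := {a : I → ℕ // a ∈ Finset.piAntidiag (Finset.univ : Finset I) m}
  have hT : ∀ a : I → ℕ, a ∈ Finset.piAntidiag (Finset.univ : Finset I) m ↔ ∑ i, a i = m := by
    intro a; simp [Finset.mem_piAntidiag]
  let S := T ⊕ I
  let key : I → S → ℤ := fun i =>
    Sum.elim (fun a => (a.1 i : ℤ)) fun j => if j = i then -1 else m + 1
  let u : I → S → ℤ ×ₗ Fin (Fintype.card S) := fun i s => toLex (key i s, Fintype.equivFin S s)
  have hu : ∀ i, Function.Injective (u i) := fun i s t h =>
    (Fintype.equivFin S).injective (congrArg Prod.snd (toLex.injective h))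
  have hlt : ∀ i s t, key i s < key i t → u i s < u i t := fun i s t h =>
    Prod.Lex.toLex_lt_toLex.2 (Or.inl h)
  have hbot : ∀ i (y : S), y ≠ Sum.inr i → u i (Sum.inr i) < u i y := by
    rintro i (a | j) hy
    · refine hlt _ _ _ ?_
      simp only [key, Sum.elim_inl, Sum.elim_inr, if_true]
      omega
    · refine hlt _ _ _ ?_
      have : j ≠ i := fun h => hy (h ▸ rfl)
      simp only [key, Sum.elim_inr, if_true, if_neg this]
      omega
  have htop : ∀ i j (y : S), j ≠ i → y ∉ Set.range (Sum.inr : I → S) →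
      u i y < u i (Sum.inr j) := by
    rintro i j (a | k) hj hy
    · refine hlt _ _ _ ?_
      have : a.1 i ≤ m := by
        exact (Finset.single_le_sum (fun _ _ => Nat.zero_le _) (Finset.mem_univ i)).trans
          ((hT a.1).1 a.2).le
      simp only [key, Sum.elim_inl, Sum.elim_inr, if_neg hj]
      omega
    · exact absurd ⟨k, rfl⟩ hy
  have hne : ∃ y : S, y ∉ Set.range (Sum.inr : I → S) := by
    obtain ⟨i⟩ := ‹Nonempty I›
    exact ⟨Sum.inl ⟨Pi.single i m, (hT _).2 (by simp)⟩, by simp⟩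
  obtain ⟨τ, hdom, -, hcol⟩ := exists_dominant_colorful hu Sum.inr hbot htop hne
    (Sum.elim (fun a : T => c a.1) id) fun i => rfl
  let C : Finset I := Finset.univ.filter fun i => (Sum.inr i : S) ∉ τ
  let A : Finset (I → ℕ) :=
    (Finset.univ.filter fun a : T => (Sum.inl a : S) ∈ τ).map (Function.Embedding.subtype _)
  have hA : ∀ a, a ∈ A ↔ ∃ h : a ∈ Finset.piAntidiag Finset.univ m,
      (Sum.inl ⟨a, h⟩ : S) ∈ τ := by
    intro a; simp [A, T]
  have hAsum : ∀ a ∈ A, ∑ i, a i = m := fun a ha => (hT a).1 ((hA a).1 ha).1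
  have hC : ∀ i, i ∉ C → (Sum.inr i : S) ∈ τ := fun i hi => by simpa [C] using hi
  have hAC : ∀ i ∈ C, ∃ a ∈ A, c a = i := by
    intro i hi
    obtain ⟨x | j, hx, hxc⟩ := hcol i
    · exact ⟨x.1, (hA _).2 ⟨x.2, hx⟩, hxc⟩
    · obtain rfl : j = i := hxc
      simp [C, hx] at hi
  obtain ⟨i₁, hi₁⟩ : C.Nonempty := by
    by_contra hCe
    rw [Finset.not_nonempty_iff_eq_empty] at hCe
    obtain ⟨y, hy⟩ := hne
    obtain ⟨i, hi⟩ := hdom y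
    exact absurd (hi _ (hC i (by simp [hCe]))) (not_le.2 (hbot i y fun h => hy ⟨i, h.symm⟩))
  have hAne : A.Nonempty := let ⟨a, ha, _⟩ := hAC i₁ hi₁; ⟨a, ha⟩
  choose p hpA hpmin using fun i => A.exists_min_image (fun a => a i) hAne
  have hbig : m < ∑ i ∈ C, (p i i + 1) := by
    by_contra! hle
    let b : I → ℕ := fun i => (if i ∈ C then p i i + 1 else 0) +
      if i = i₁ then m - ∑ i ∈ C, (p i i + 1) else 0
    have hb : ∑ i, b i = m := by
      simp only [b, Finset.sum_add_distrib, Finset.sum_ite_eq', Finset.sum_ite_mem,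
        Finset.univ_inter, Finset.mem_univ, if_true] at hle ⊢
      omega
    obtain ⟨i, hi⟩ := hdom (Sum.inl ⟨b, (hT b).2 hb⟩)
    by_cases hiC : i ∈ C
    · obtain ⟨h, hmem⟩ := (hA _).1 (hpA i)
      refine absurd (hi _ hmem) (not_le.2 (hlt _ _ _ ?_))
      simp only [key, Sum.elim_inl, b, if_pos hiC]
      push_cast
      have : (0 : ℤ) ≤ if i = i₁ then ((m - ∑ i ∈ C, (p i i + 1) : ℕ) : ℤ) else 0 := by
        split_ifs <;> positivity
      omega
    · exact absurd (hi _ (hC i hiC)) (not_le.2 (hbot i _ (by simp)))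
  have hcard : C.card ≤ Fintype.card I := Finset.card_le_univ C
  rw [Finset.sum_add_distrib, Finset.sum_const, smul_eq_mul, mul_one] at hbig
  have hsub : ∀ D : Finset I, ∀ a ∈ A, ∑ i ∈ D, a i ≤ m := fun D a ha => by
    rw [← hAsum a ha]; exact Finset.sum_le_sum_of_subset (Finset.subset_univ D)
  refine ⟨A, C, hAne, hAsum, hAC, fun i hi a ha b hb => ?_, fun i hi a ha => ?_⟩
  · have h1 := hsub C a ha
    have h2 : ∑ j ∈ C.erase i, p j j ≤ ∑ j ∈ C.erase i, a j :=
      Finset.sum_le_sum fun j _ => hpmin j a ha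
    have h3 := hpmin i b hb
    rw [← Finset.add_sum_erase _ _ hi] at hbig h1
    omega
  · have h1 := hsub (insert i C) a ha
    have h2 : ∑ j ∈ C, p j j ≤ ∑ j ∈ C, a j := Finset.sum_le_sum fun j _ => hpmin j a ha
    rw [Finset.sum_insert hi] at h1
    omega

/-- Approximate form of Brouwer's fixed point theorem for the standard simplex. -/
theorem exists_forall_le_add_of_continuousOn_stdSimplex {g : (I → ℝ) → I → ℝ}
    (hg : ContinuousOn g (stdSimplex ℝ I)) (hmaps : Set.MapsTo g (stdSimplex ℝ I) (stdSimplex ℝ I))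
    {ε : ℝ} (hε : 0 < ε) : ∃ x ∈ stdSimplex ℝ I, ∀ i, x i ≤ g x i + ε := by
  obtain ⟨δ, hδ, hδg⟩ := Metric.uniformContinuousOn_iff.1
    ((isCompact_stdSimplex ℝ I).uniformContinuousOn_of_continuous hg) (ε / 2) (half_pos hε)
  set n := Fintype.card I
  obtain ⟨m, hm⟩ := exists_nat_gt ((n : ℝ) / min δ (ε / 2))
  have hmin : 0 < min δ (ε / 2) := lt_min hδ (half_pos hε)
  have hm0 : (0 : ℝ) < m := lt_of_le_of_lt (by positivity) hm
  have hnm : (n : ℝ) / m < min δ (ε / 2) := by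
    rw [div_lt_iff₀ hmin] at hm
    rw [div_lt_iff₀ hm0]; linarith
  have hnδ := hnm.trans_le (min_le_left _ _)
  have hnε := hnm.trans_le (min_le_right _ _)
  let q : (I → ℕ) → I → ℝ := fun a i => a i / m
  have hq : ∀ a : I → ℕ, ∑ i, a i = m → q a ∈ stdSimplex ℝ I := fun a ha =>
    ⟨fun i => by positivity, by
      simp only [q]
      rw [← Finset.sum_div, ← Nat.cast_sum, ha, div_self hm0.ne']⟩
  have hcol : ∀ a : I → ℕ, ∃ i, ∑ i, a i = m → q a i ≤ g (q a) i := by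
    intro a
    by_cases ha : ∑ i, a i = m
    · obtain ⟨i, -, hi⟩ := Finset.exists_le_of_sum_le (s := Finset.univ) (f := q a)
        (g := g (q a)) Finset.univ_nonempty
        (by rw [(hq a ha).2, (hmaps (hq a ha)).2])
      exact ⟨i, fun _ => hi⟩
    · exact ⟨Classical.arbitrary I, fun h => absurd h ha⟩
  choose c hc using hcol
  obtain ⟨A, C, ⟨a, ha⟩, hsum, hAC, hnear, hsmall⟩ := exists_cluster_colorful m c
  refine ⟨q a, hq a (hsum a ha), fun i => ?_⟩
  have hcoord : ∀ k, ∀ a ∈ A, ∀ b ∈ A, q a k - q b k ≤ n / m := by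
    intro k a ha b hb
    simp only [q]
    rw [← sub_div]
    gcongr
    rw [sub_le_iff_le_add']
    by_cases hk : k ∈ C
    · exact_mod_cast hnear k hk a ha b hb
    · exact_mod_cast (hsmall k hk a ha).trans (Nat.le_add_left _ _)
  by_cases hi : i ∈ C
  · obtain ⟨b, hb, hbi⟩ := hAC i hi
    have h1 := hc b (hsum b hb)
    rw [hbi] at h1
    have h2 := hcoord i a ha b hb
    have h3 : dist (q a) (q b) < δ := by
      rw [dist_pi_lt_iff hδ]
      intro k
      rw [Real.dist_eq, abs_sub_lt_iff]
      exact ⟨(hcoord k a ha b hb).trans_lt hnδ, (hcoord k b hb a ha).trans_lt hnδ⟩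
    have h4 := (dist_le_pi_dist _ _ i).trans_lt
      (hδg _ (hq a (hsum a ha)) _ (hq b (hsum b hb)) h3)
    rw [Real.dist_eq, abs_sub_lt_iff] at h4
    linarith [h4.2]
  · have h1 : q a i ≤ n / m := by
      simp only [q]
      gcongr
      exact hsmall i hi a ha
    have h2 := (hmaps (hq a (hsum a ha))).1 i
    linarith

/-- Brouwer's fixed point theorem for the standard simplex. -/
theorem exists_fixedPoint_of_continuousOn_stdSimplex {g : (I → ℝ) → I → ℝ}
    (hg : ContinuousOn g (stdSimplex ℝ I))
    (hmaps : Set.MapsTo g (stdSimplex ℝ I) (stdSimplex ℝ I)) : ∃ x ∈ stdSimplex ℝ I, g x = x := by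
  classical
  have hcont : ContinuousOn (fun x => ∑ i, max (x i - g x i) 0) (stdSimplex ℝ I) := by
    fun_prop
  obtain ⟨x, hx, hmin⟩ := (isCompact_stdSimplex ℝ I).exists_isMinOn
    ⟨_, single_mem_stdSimplex ℝ (Classical.arbitrary I)⟩ hcont
  have hle : ∑ i, max (x i - g x i) 0 ≤ 0 := by
    by_contra! hpos
    have hn : (0 : ℝ) < Fintype.card I := Nat.cast_pos.2 Fintype.card_pos
    obtain ⟨y, hy, hyg⟩ := exists_forall_le_add_of_continuousOn_stdSimplex hg hmaps
      (ε := (∑ i, max (x i - g x i) 0) / (2 * Fintype.card I)) (by positivity)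
    have h1 := hmin hy
    have h2 : ∑ i, max (y i - g y i) 0 ≤
        ∑ _i : I, (∑ i, max (x i - g x i) 0) / (2 * Fintype.card I) :=
      Finset.sum_le_sum fun i _ => max_le (by linarith [hyg i]) (by positivity)
    rw [Finset.sum_const, Finset.card_univ, nsmul_eq_mul] at h2
    have h3 : (Fintype.card I : ℝ) * ((∑ i, max (x i - g x i) 0) / (2 * Fintype.card I)) =
        (∑ i, max (x i - g x i) 0) / 2 := by field_simp
    have h1' : ∑ i, max (x i - g x i) 0 ≤ ∑ i, max (y i - g y i) 0 := h1
    linarith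
  have hxg : ∀ i ∈ Finset.univ, x i ≤ g x i := by
    intro i _
    have := (Finset.single_le_sum (f := fun i => max (x i - g x i) 0)
      (fun _ _ => le_max_right _ _) (Finset.mem_univ i)).trans hle
    linarith [le_max_left (x i - g x i) 0]
  have heq := (Finset.sum_eq_sum_iff_of_le hxg).1 (by rw [hx.2, (hmaps hx).2])
  exact ⟨x, hx, funext fun i => (heq i (Finset.mem_univ i)).symm⟩

end Brouwer

/-- Schauder projection argument: a continuous map from the standard simplex whose values are close
to the points `z i` takes at some `s` a value close to the convex combination of the `z i` with
weights `s`. -/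
theorem exists_sub_sum_smul_mem_of_continuousOn {X I : Type*} [AddCommGroup X] [Module ℝ X]
    [TopologicalSpace X] [IsTopologicalAddGroup X] [ContinuousSMul ℝ X] [Fintype I] [Nonempty I]
    {W : Set X} (hW : Convex ℝ W) (hW0 : W ∈ 𝓝 0) (z : I → X) {h : (I → ℝ) → X}
    (hh : ContinuousOn h (stdSimplex ℝ I))
    (hz : ∀ s ∈ stdSimplex ℝ I, ∃ i, gauge W (h s - z i) < 1) :
    ∃ s ∈ stdSimplex ℝ I, h s - ∑ i, s i • z i ∈ W := by
  have hgauge := continuous_gauge hW hW0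
  let φ : (I → ℝ) → I → ℝ := fun s i => max (1 - gauge W (h s - z i)) 0
  have hφ0 : ∀ s i, 0 ≤ φ s i := fun s i => le_max_right _ _
  have hφc : ∀ i, ContinuousOn (fun s => φ s i) (stdSimplex ℝ I) := by
    intro i
    have : ContinuousOn (fun s => gauge W (h s - z i)) (stdSimplex ℝ I) :=
      hgauge.comp_continuousOn (hh.sub continuousOn_const)
    exact (continuousOn_const.sub this).sup continuousOn_const
  have hpos : ∀ s ∈ stdSimplex ℝ I, 0 < ∑ i, φ s i := by
    intro s hs
    obtain ⟨i, hi⟩ := hz s hs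
    exact Finset.sum_pos' (fun i _ => hφ0 s i)
      ⟨i, Finset.mem_univ i, lt_max_of_lt_left (sub_pos.2 hi)⟩
  obtain ⟨s, hs, hfix⟩ := exists_fixedPoint_of_continuousOn_stdSimplex
    (g := fun s i => φ s i / ∑ j, φ s j)
    (continuousOn_pi.2 fun i => (hφc i).div (continuousOn_finsetSum _ fun j _ => hφc j)
      fun s hs => (hpos s hs).ne')
    (fun s hs => ⟨fun i => div_nonneg (hφ0 s i) (hpos s hs).le, by
      rw [← Finset.sum_div, div_self (hpos s hs).ne']⟩)
  refine ⟨s, hs, ?_⟩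
  have h1 : h s - ∑ i, s i • z i = ∑ i with s i ≠ 0, s i • (h s - z i) := by
    rw [Finset.sum_filter_of_ne (p := fun i => s i ≠ 0)
      fun i _ hi hsi => hi (by rw [hsi, zero_smul])]
    simp only [smul_sub, Finset.sum_sub_distrib]
    rw [← Finset.sum_smul, hs.2, one_smul]
  rw [h1]
  refine hW.sum_mem (fun i _ => hs.1 i) ?_ fun i hi => ?_
  · rw [Finset.sum_filter_ne_zero, hs.2]
  · have hsi := (Finset.mem_filter.1 hi).2
    by_contra hmem
    refine hsi ?_
    rw [← congrFun hfix i]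
    have : 1 ≤ gauge W (h s - z i) := by
      by_contra! hlt
      exact hmem (setOfPred_gauge_lt_one_subset_self hW (mem_of_mem_nhds hW0)
        (absorbent_nhds_zero hW0) hlt)
    simp only [φ, max_eq_right (sub_nonpos.2 this), zero_div]

theorem exists_sub_mem_of_almostConvex {X : Type u} [AddCommGroup X] [Module ℝ X]
    (T : TopologicalSpace X) (hTadd : @IsTopologicalAddGroup X T _)
    (hTsmul : @ContinuousSMul ℝ X _ _ T)
    [R : TopologicalSpace X] [hRadd : IsTopologicalAddGroup X] [ContinuousSMul ℝ X]
    (hTR : T ≤ R) (C : Set X) (hC : AlmostConvex T C) (f : C → X) (hfcl : ∀ x, f x ∈ closure[T] C)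
    (hf : @SeqContinuous C X (TopologicalSpace.induced Subtype.val T) R f)
    (hfC : @TotallyBounded X (@IsTopologicalAddGroup.rightUniformSpace X _ R hRadd) (Set.range f))
    {W : Set X} (hW0 : W ∈ 𝓝 0) (hWc : Convex ℝ W) (hWb : ∀ x ∈ W, -x ∈ W) :
    ∃ x : C, (x : X) - f x ∈ W := by
  have habs := absorbent_nhds_zero (𝕜 := ℝ) hW0
  let V : Set X := {x | gauge W x < 1 / 3}
  have hV : V ∈ 𝓝 0 :=
    (continuous_gauge hWc hW0).continuousAt.eventually_lt continuousAt_const (by simp)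
  have hsymm : ∀ x, gauge W (-x) = gauge W x := gauge_neg hWb
  obtain ⟨t, htr, htfin, ht⟩ : ∃ t ⊆ Set.range f, t.Finite ∧ ∀ x, ∃ y ∈ t, f x - y ∈ V := by
    let := IsTopologicalAddGroup.rightUniformSpace X
    have := isUniformAddGroup_of_addCommGroup (G := X)
    have hU : {p : X × X | p.1 - p.2 ∈ V} ∈ uniformity X := by
      rw [uniformity_eq_comap_nhds_zero_swapped]
      exact preimage_mem_comap hV
    obtain ⟨t, htr, htfin, ht⟩ := totallyBounded_iff_subset.1 hfC _ hU
    refine ⟨t, htr, htfin, fun x => ?_⟩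
    obtain ⟨y, hy, hxy⟩ := Set.mem_iUnion₂.1 (ht ⟨x, rfl⟩)
    exact ⟨y, hy, hxy⟩
  obtain ⟨n, y, hy⟩ := htfin.fin_embedding
  have hyt : ∀ i, y i ∈ t := fun i => hy ▸ Set.mem_range_self i
  have : Nonempty (Fin n) := by
    obtain ⟨x, hx⟩ := hC.1
    obtain ⟨w, hw, -⟩ := ht ⟨x, hx⟩
    rw [← hy] at hw
    exact ⟨hw.choose⟩
  have hVT : V ∈ @nhds X T 0 := nhds_mono hTR hV
  have hclose : ∀ i, ∃ c ∈ C, c - y i ∈ V := by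
    intro i
    have hcl : y i ∈ closure[T] C := by
      obtain ⟨x, hx⟩ := htr (hyt i)
      exact hx ▸ hfcl x
    have hmem : (fun c => c - y i) ⁻¹' V ∈ @nhds X T (y i) := by
      have hcont : Continuous[T, T] (fun c => c - y i) := by
        let := T
        exact continuous_id.sub continuous_const
      have := @Continuous.continuousAt _ _ T T _ (y i) hcont
      refine this ?_
      simpa using hVT
    obtain ⟨c, hc, hcC⟩ := (@mem_closure_iff_nhds X T (y i) C).1 hcl _ hmem
    exact ⟨c, hcC, hc⟩
  choose c hcC hc using hclose
  obtain ⟨z, hzC, hzco, hz⟩ := hC.2 V hVT n c hcC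
  have hsum : ∀ s ∈ stdSimplex ℝ (Fin n), ∑ i, s i • z i ∈ C := fun s hs =>
    hzco ((convex_convexHull ℝ _).sum_mem (fun i _ => hs.1 i) hs.2
      fun i _ => subset_convexHull ℝ _ ⟨i, rfl⟩)
  let F : stdSimplex ℝ (Fin n) → C := fun s => ⟨∑ i, s.1 i • z i, hsum s.1 s.2⟩
  have hcont : Continuous (fun s => f (F s)) := by
    refine SeqContinuous.continuous ?_
    intro u s hu
    refine hf ?_
    let := T
    have hF : Continuous F := by
      refine Continuous.subtype_mk ?_ _
      exact continuous_finsetSum _ fun i _ =>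
        ((continuous_apply i).comp continuous_subtype_val).smul continuous_const
    exact (hF.tendsto s).comp hu
  classical
  let h : (Fin n → ℝ) → X := fun s => if hs : s ∈ stdSimplex ℝ (Fin n) then f (F ⟨s, hs⟩) else 0
  have hh : ∀ s : stdSimplex ℝ (Fin n), h s.1 = f (F s) := fun s => dif_pos s.2
  obtain ⟨s, hs, hsW⟩ := exists_sub_sum_smul_mem_of_continuousOn hWc hW0 z (h := h)
    (continuousOn_iff_continuous_domRestrict.2 (by convert hcont using 2 with s; exact hh s))
    fun s hs => by
      obtain ⟨w, hw, hfw⟩ := ht (F ⟨s, hs⟩)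
      rw [← hy] at hw
      obtain ⟨i, rfl⟩ := hw
      refine ⟨i, ?_⟩
      rw [hh ⟨s, hs⟩]
      have h1 : f (F ⟨s, hs⟩) - z i = (f (F ⟨s, hs⟩) - y i) + (-(c i - y i) + -(z i - c i)) := by
        abel
      have h2 : gauge W (c i - y i) < 1 / 3 := hc i
      have h3 : gauge W (z i - c i) < 1 / 3 := hz i
      have h4 : gauge W (f (F ⟨s, hs⟩) - y i) < 1 / 3 := hfw
      have h5 := gauge_add_le hWc habs (f (F ⟨s, hs⟩) - y i) (-(c i - y i) + -(z i - c i))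
      have h6 := gauge_add_le hWc habs (-(c i - y i)) (-(z i - c i))
      rw [hsymm, hsymm] at h6
      rw [h1]
      linarith
  rw [hh ⟨s, hs⟩] at hsW
  refine ⟨F ⟨s, hs⟩, ?_⟩
  rw [← neg_sub]
  exact hWb _ hsW

theorem mainTheorem3 {X : Type u} [AddCommGroup X] [Module ℝ X]
    (T : TopologicalSpace X) (hTadd : @IsTopologicalAddGroup X T _)
    (hTsmul : @ContinuousSMul ℝ X _ _ T)
    (R : TopologicalSpace X) (hRadd : @IsTopologicalAddGroup X R _)
    (hRsmul : @ContinuousSMul ℝ X _ _ R) (hRconv : @LocallyConvexSpace ℝ X _ _ _ _ R)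
    (hTR : ∀ U : Set X, IsOpen[R] U → IsOpen[T] U)
    (C : Set X) (hC : AlmostConvex T C)
    (f : C → closure[T] C)
    (hf : @SeqContinuous C X (TopologicalSpace.induced Subtype.val T) R (fun x => (f x : X)))
    (hfC : @TotallyBounded X (@IsTopologicalAddGroup.rightUniformSpace X _ R hRadd)
      (Set.range fun x => (f x : X))) :
    HasApproxFixedPointNet R (fun x : C => (f x : X)) := by
  have key : ∀ U : {U : Set X // U ∈ 𝓝 (0 : X)}, ∃ x : C, (x : X) - f x ∈ U.1 := by
    rintro ⟨U, hU⟩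
    obtain ⟨W, ⟨hW0, hWb, hWc⟩, hWU⟩ := (nhds_hasBasis_absConvex ℝ X).mem_iff.1 hU
    obtain ⟨x, hx⟩ := exists_sub_mem_of_almostConvex T hTadd hTsmul (fun U hU => hTR U hU) C hC
      (fun x => (f x : X)) (fun x => (f x).2) hf hfC hW0 hWc fun x hx => hWb.neg_mem_iff.2 hx
    exact ⟨x, hWU hx⟩
  choose x hx using key
  refine ⟨{U : Set X // U ∈ 𝓝 (0 : X)}ᵒᵈ, inferInstance, ⟨fun U V => ?_⟩,
    ⟨OrderDual.toDual ⟨Set.univ, univ_mem⟩⟩, fun U => x (OrderDual.ofDual U), ?_⟩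
  · exact ⟨OrderDual.toDual ⟨(OrderDual.ofDual U).1 ∩ (OrderDual.ofDual V).1,
      inter_mem (OrderDual.ofDual U).2 (OrderDual.ofDual V).2⟩,
      Set.inter_subset_left, Set.inter_subset_right⟩
  · intro U hU
    have : Nonempty {U : Set X // U ∈ 𝓝 (0 : X)}ᵒᵈ := ⟨OrderDual.toDual ⟨U, hU⟩⟩
    exact mem_map.2 (mem_of_superset (mem_atTop (OrderDual.toDual ⟨U, hU⟩))
      fun V hV => hV (hx (OrderDual.ofDual V)))
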